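/- Let $(W,S)$ be a Coxeter system with $S=\{s_1,\dots,s_n\}$ finite (the $s_i$ pairwise distinct, numbered in an arbitrary order), and let $u=s_1\cdots s_n$ be the corresponding Coxeter element, that is, the product of all the generators in $S$, each occurring exactly once. Let $\ell$ denote the word length on $W$ with respect to $S$. Call an element $w\in W$ straight if $\ell(w^k)=k\,\ell(w)$ for all $k\in\mathbb{N}$. The irreducible components of $W$ are the subgroups $W_I=\langle I\rangle$ where $I\subseteq S$ runs over the vertex sets of the connected components of the Coxeter diagram of $(W,S)$. Then $u$ is straight if and only if every irreducible component of $W$ is infinite. -/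

import Mathlib

/-- The graph underlying the Coxeter diagram: vertices are the indices of the simple reflections,
and two distinct indices are joined when the corresponding entry of the Coxeter matrix is not `2`
(the entry `0` encodes infinity, so it also gives an edge). -/
def CoxeterMatrix.diagramGraph {B : Type*} (M : CoxeterMatrix B) : SimpleGraph B where
  Adj i j := i ≠ j ∧ M i j ≠ 2
  symm := ⟨fun i j h => ⟨h.1.symm, by rw [M.symmetric j i]; exact h.2⟩⟩
  loopless := ⟨fun _ h => h.1 rfl⟩

/-- The standard parabolic subgroup generated by the simple reflections indexed by `I`. -/
def CoxeterSystem.standardParabolic {B W : Type*} [Group W] {M : CoxeterMatrix B}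
    (cs : CoxeterSystem M W) (I : Set B) : Subgroup W :=
  Subgroup.closure (cs.simple '' I)

/-- Every irreducible component of the Coxeter system, that is, every standard parabolic subgroup
generated by a connected component of the Coxeter diagram, is infinite. -/
def CoxeterSystem.HasOnlyInfiniteComponents {B W : Type*} [Group W] {M : CoxeterMatrix B}
    (cs : CoxeterSystem M W) : Prop :=
  ∀ C : M.diagramGraph.ConnectedComponent, Infinite (cs.standardParabolic C.supp)

/-- An element `w` is straight if `ℓ(w ^ n) = n * ℓ(w)` for all natural numbers `n`. -/
def CoxeterSystem.IsStraight {B W : Type*} [Group W] {M : CoxeterMatrix B}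
    (cs : CoxeterSystem M W) (w : W) : Prop :=
  ∀ n : ℕ, cs.length (w ^ n) = n * cs.length w

/-- A Coxeter element is a product of all the simple reflections, each occurring exactly once, in
some order. In particular, its existence forces the index set `B` to be finite. -/
def CoxeterSystem.IsCoxeterElement {B W : Type*} [Group W] {M : CoxeterMatrix B}
    (cs : CoxeterSystem M W) (u : W) : Prop :=
  ∃ ω : List B, ω.Nodup ∧ (∀ i : B, i ∈ ω) ∧ cs.wordProd ω = u

/-! Let α_i be the simple roots of the geometric representation. A word enumerating S carries a skew
form ω; moving its first letter i to the end transports ω by s_i (`skewForm_rotate`), and ω(α_i, y)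
≥ 0 for y ≥ 0 when i is the first letter.

Suppose all components are infinite and some prefix w of the periodic word s_1⋯s_n s_1⋯s_n⋯ is
reduced, but not after appending the next letter j. Let i be the first letter of w. Removing i
leaves a word that is reduced even with j appended, by induction, so w α_j = -α_i. For a positive
root γ with w⁻¹γ > 0, comparing ω(α_i, γ) with the transported form at (α_j, w⁻¹γ) gives both signs,
so it is 0 and γ vanishes at the neighbours of i. Only finitely many positive roots are made
negative by w⁻¹, so finitely many roots involve a neighbour of i; this finiteness spreads along the
diagram and makes the component of i finite
(`finite_standardParabolic_of_forall_adj_apply_eq_zero`), a contradiction. So all powers of u are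
reduced as written (`isReduced_cyclicWord`).

Conversely, a finite component contributes a commuting factor of finite order, and a suitable power
of u is too short. -/

namespace CoxeterMatrix

/-! ### Cartan matrix and simple reflections. -/

variable {B : Type*} (M : CoxeterMatrix B)

/-- The entries `-2 cos (π / M i j)` of the (normalized) Cartan matrix of a Coxeter matrix. An entry
`M i j = 0`, which encodes infinity, gives the value `-2`. -/
noncomputable def cartan (i j : B) : ℝ := -2 * Real.cos (Real.pi / M i j)

theorem cartan_symm (i j : B) : M.cartan i j = M.cartan j i := by
  rw [cartan, cartan, M.symmetric]

@[simp] theorem cartan_self (i : B) : M.cartan i i = 2 := by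
  simp [cartan]

theorem two_le_of_ne_of_ne_zero {i j : B} (h : i ≠ j) (h0 : M i j ≠ 0) : 2 ≤ M i j := by
  have := M.off_diagonal i j h
  omega

theorem cartan_nonpos {i j : B} (h : i ≠ j) : M.cartan i j ≤ 0 := by
  suffices 0 ≤ Real.cos (Real.pi / M i j) by rw [cartan]; linarith
  have hpi := Real.pi_pos
  rcases eq_or_ne (M i j) 0 with h0 | h0
  · simp [h0]
  have h2 : (2 : ℝ) ≤ M i j := by exact_mod_cast M.two_le_of_ne_of_ne_zero h h0
  refine Real.cos_nonneg_of_neg_pi_div_two_le_of_le ?_ ?_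
  · have : 0 ≤ Real.pi / M i j := by positivity
    linarith
  · gcongr

theorem cartan_eq_zero_of_eq_two {i j : B} (h : M i j = 2) : M.cartan i j = 0 := by
  simp [cartan, h]

theorem cartan_neg_of_adj {i j : B} (h : M.diagramGraph.Adj i j) : M.cartan i j < 0 := by
  suffices 0 < Real.cos (Real.pi / M i j) by rw [cartan]; linarith
  have hpi := Real.pi_pos
  rcases eq_or_ne (M i j) 0 with h0 | h0
  · simp [h0]
  have h3 : 3 ≤ M i j := by
    have := M.two_le_of_ne_of_ne_zero h.1 h0
    have := h.2
    omega
  have h3' : (3 : ℝ) ≤ M i j := by exact_mod_cast h3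
  apply Real.cos_pos_of_mem_Ioo
  constructor
  · have : 0 ≤ Real.pi / M i j := by positivity
    linarith
  · rw [div_lt_div_iff_of_pos_left hpi (by linarith) (by norm_num)]
    linarith

variable [Fintype B]

/-- The linear form pairing a vector with the simple coroot of index `i`. -/
noncomputable def coroot (i : B) : Module.Dual ℝ (B → ℝ) :=
  ∑ j, M.cartan i j • LinearMap.proj j

theorem coroot_apply (i : B) (x : B → ℝ) : M.coroot i x = ∑ j, M.cartan i j * x j := by
  simp [coroot]

variable [DecidableEq B]

theorem coroot_single (i j : B) : M.coroot i (Pi.single j 1) = M.cartan i j := by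
  simp [coroot_apply, Pi.single_apply]

theorem coroot_single_self (i : B) : M.coroot i (Pi.single i 1) = 2 := by
  simp [coroot_single]

/-- The reflection in the simple root of index `i`. -/
noncomputable def simpleReflection (i : B) : (B → ℝ) ≃ₗ[ℝ] (B → ℝ) :=
  Module.reflection (M.coroot_single_self i)

theorem simpleReflection_apply (i : B) (x : B → ℝ) :
    M.simpleReflection i x = x - M.coroot i x • Pi.single i 1 :=
  rfl

theorem simpleReflection_apply_of_ne {i j : B} (h : j ≠ i) (x : B → ℝ) :
    M.simpleReflection i x j = x j := by
  simp [simpleReflection_apply, h]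

theorem simpleReflection_apply_self (i : B) (x : B → ℝ) :
    M.simpleReflection i x i = x i - M.coroot i x := by
  simp [simpleReflection_apply]

theorem simpleReflection_mul_self (i : B) :
    M.simpleReflection i * M.simpleReflection i = 1 := by
  ext1 x
  exact Module.involutive_reflection (M.coroot_single_self i) x

-- For 3 ≤ m the product of two reflections acts as a rotation by φ = 2π/m, and its powers have
-- Chebyshev coefficients, which vanish or cancel at exponent m.
open Polynomial.Chebyshev in
theorem isLiftable_simpleReflection : M.IsLiftable M.simpleReflection := by
  intro i j
  rcases eq_or_ne i j with rfl | hij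
  · simp [simpleReflection_mul_self]
  have hij1 := M.off_diagonal i j hij
  obtain h0 | h2 | h3 : M i j = 0 ∨ M i j = 2 ∨ 3 ≤ M i j := by omega
  · simp [h0]
  · have hc := M.cartan_eq_zero_of_eq_two h2
    have hc' : M.cartan j i = 0 := by rw [cartan_symm, hc]
    rw [h2, pow_two]
    ext1 x
    simp only [LinearEquiv.mul_apply, simpleReflection_apply, map_sub, map_smul, coroot_single,
      cartan_self, hc, hc', LinearEquiv.coe_one, id_eq]
    module
  · set m := M i j with hm
    have h3' : (3 : ℝ) ≤ m := by exact_mod_cast h3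
    have hpi := Real.pi_pos
    set φ : ℝ := 2 * Real.pi / m with hφ
    have hmφ : m * φ = 2 * Real.pi := by rw [hφ]; field_simp
    have hsin : Real.sin φ ≠ 0 := by
      apply (Real.sin_pos_of_pos_of_lt_pi (by positivity) _).ne'
      rw [hφ, div_lt_iff₀ (by linarith)]
      nlinarith
    have ht : (2 * Real.cos φ : ℝ) =
        M.coroot i (Pi.single j 1) * M.coroot j (Pi.single i 1) - 2 := by
      rw [coroot_single, coroot_single, M.cartan_symm j i, cartan, ← hm,
        show φ = 2 * (Real.pi / m) by rw [hφ]; ring, Real.cos_two_mul]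
      ring
    have hS (n : ℤ) : (S ℝ n).eval (2 * Real.cos φ) = Real.sin ((n + 1) * φ) / Real.sin φ := by
      rw [eq_div_iff hsin, S_two_mul_real_cos]
    ext1 z
    rw [simpleReflection, simpleReflection, Module.reflection_mul_reflection_pow_apply _ _ _ _ _ ht]
    -- The Chebyshev indices are halves of m rounded down, hence the split by parity.
    obtain ⟨k, hk | hk⟩ := Nat.even_or_odd' m
    · have e1 : ((m : ℤ) - 2) / 2 = k - 1 := by omega
      have e2 : ((m : ℤ) - 1) / 2 = k - 1 := by omega
      have hkφ : (k : ℝ) * φ = Real.pi := by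
        have : (m : ℝ) = 2 * k := by exact_mod_cast hk
        rw [this] at hmφ
        linarith
      have h0 : (S ℝ ((k : ℤ) - 1)).eval (2 * Real.cos φ) = 0 := by
        rw [hS]
        push_cast
        rw [sub_add_cancel, hkφ, Real.sin_pi, zero_div]
      simp [e1, e2, h0]
    · have e1 : ((m : ℤ) - 2) / 2 = k - 1 := by omega
      have e2 : ((m : ℤ) - 1) / 2 = k := by omega
      have e3 : ((m : ℤ) - 3) / 2 = k - 1 := by omega
      have e4 : (m : ℤ) / 2 = k := by omega
      have hkφ : ((k : ℝ) + 1) * φ = 2 * Real.pi - k * φ := by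
        have : (m : ℝ) = 2 * k + 1 := by exact_mod_cast hk
        rw [this] at hmφ
        linarith
      have h0 : (S ℝ (k : ℤ)).eval (2 * Real.cos φ) +
          (S ℝ ((k : ℤ) - 1)).eval (2 * Real.cos φ) = 0 := by
        rw [hS, hS]
        push_cast
        rw [sub_add_cancel, hkφ, Real.sin_two_pi_sub, neg_div, neg_add_cancel]
      simp [e1, e2, e3, e4, h0]

/-- The coefficients of the roots of a dihedral subsystem of the root system of a Coxeter matrix. -/
noncomputable def dihedralCoeff (m k : ℕ) : ℝ :=
  if m = 0 then k else Real.sin (k * (Real.pi / m)) / Real.sin (Real.pi / m)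

end CoxeterMatrix
-- Dihedral coefficients and the sign of roots.
namespace CoxeterMatrix

theorem dihedralCoeff_zero (m : ℕ) : dihedralCoeff m 0 = 0 := by
  simp [dihedralCoeff]

theorem sin_pi_div_pos {m : ℕ} (h0 : m ≠ 0) (h1 : m ≠ 1) : 0 < Real.sin (Real.pi / m) := by
  have hpi := Real.pi_pos
  have h2 : (2 : ℝ) ≤ m := by exact_mod_cast (by omega : 2 ≤ m)
  apply Real.sin_pos_of_pos_of_lt_pi (by positivity)
  rw [div_lt_iff₀ (by linarith)]
  nlinarith

theorem dihedralCoeff_one {m : ℕ} (h1 : m ≠ 1) : dihedralCoeff m 1 = 1 := by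
  by_cases h0 : m = 0
  · simp [dihedralCoeff, h0]
  · simp [dihedralCoeff, h0, (sin_pi_div_pos h0 h1).ne']

theorem dihedralCoeff_add_two (m k : ℕ) :
    dihedralCoeff m (k + 2) =
      2 * Real.cos (Real.pi / m) * dihedralCoeff m (k + 1) - dihedralCoeff m k := by
  by_cases h0 : m = 0
  · simp [dihedralCoeff, h0]
    ring
  · simp only [dihedralCoeff, h0, if_false]
    push_cast
    rw [← mul_div_assoc (2 * _), ← sub_div]
    congr 1
    set θ := Real.pi / (m : ℝ)
    rw [show ((k : ℝ) + 2) * θ = (k + 1) * θ + θ by ring,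
      show (k : ℝ) * θ = (k + 1) * θ - θ by ring, Real.sin_add, Real.sin_sub]
    ring

theorem dihedralCoeff_nonneg {m k : ℕ} (h1 : m ≠ 1) (hk : m ≠ 0 → k ≤ m) :
    0 ≤ dihedralCoeff m k := by
  by_cases h0 : m = 0
  · simp [dihedralCoeff, h0]
  · simp only [dihedralCoeff, h0, if_false]
    have hm : (0 : ℝ) < m := by exact_mod_cast Nat.pos_of_ne_zero h0
    have hpi := Real.pi_pos
    refine div_nonneg (Real.sin_nonneg_of_nonneg_of_le_pi (by positivity) ?_)
      (sin_pi_div_pos h0 h1).le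
    have : (k : ℝ) ≤ m := by exact_mod_cast hk h0
    rw [mul_div_assoc', div_le_iff₀ hm]
    nlinarith

end CoxeterMatrix

namespace CoxeterSystem

open CoxeterMatrix

variable {B W : Type*} [Group W] {M : CoxeterMatrix B} (cs : CoxeterSystem M W)

/-- Strip j, i, j, … from the right until neither is a descent. -/
theorem exists_eq_mul_alternatingWord (w : W) (i j : B) (hj : cs.IsRightDescent w j)
    (hi : ¬cs.IsRightDescent w i) :
    ∃ v : W, ∃ k : ℕ, w = v * cs.wordProd (alternatingWord i j k) ∧
      cs.length w = cs.length v + k ∧ cs.length v < cs.length w ∧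
      ¬cs.IsRightDescent v i ∧ ¬cs.IsRightDescent v j := by
  induction h : cs.length w generalizing w i j with
  | zero =>
    rw [IsRightDescent] at hj
    omega
  | succ n ih =>
    rw [isRightDescent_iff] at hj
    by_cases hi' : cs.IsRightDescent (w * cs.simple j) i
    · obtain ⟨v, k, h1, h2, h3, h4, h5⟩ := ih (w * cs.simple j) j i hi'
        ((cs.isRightDescent_iff_not_isRightDescent_mul).1 (by rw [isRightDescent_iff, hj]))
        (by omega)
      refine ⟨v, k + 1, ?_, by omega, by omega, h5, h4⟩
      rw [alternatingWord_succ, wordProd_concat, ← mul_assoc, ← h1,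
        simple_mul_simple_cancel_right]
    · refine ⟨w * cs.simple j, 1, by simp [alternatingWord], by omega, by omega, hi', ?_⟩
      exact (cs.isRightDescent_iff_not_isRightDescent_mul).1 (by rw [isRightDescent_iff, hj])

variable [Fintype B] [DecidableEq B]

/-- The geometric representation of a Coxeter group. -/
noncomputable def geometricRep : W →* ((B → ℝ) ≃ₗ[ℝ] (B → ℝ)) :=
  cs.lift ⟨M.simpleReflection, M.isLiftable_simpleReflection⟩

@[simp] theorem geometricRep_simple (i : B) :
    cs.geometricRep (cs.simple i) = M.simpleReflection i :=
  cs.lift_apply_simple _ i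

/-- The root obtained by applying `w` to the simple root of index `i`. -/
noncomputable def root (w : W) (i : B) : B → ℝ := cs.geometricRep w (Pi.single i 1)

@[simp] theorem root_one (i : B) : cs.root 1 i = Pi.single i 1 := by
  simp [root]

theorem root_mul (v w : W) (i : B) : cs.root (v * w) i = cs.geometricRep v (cs.root w i) := by
  simp [root]

theorem root_ne_zero (w : W) (i : B) : cs.root w i ≠ 0 := by
  simp [root]

theorem root_mul_simple (w : W) (i : B) : cs.root (w * cs.simple i) i = -cs.root w i := by
  simp [root, simpleReflection_apply, coroot_single_self, two_smul]

/-- Each prepended reflection alters one coordinate, exactly by the recurrence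
`dihedralCoeff_add_two`. -/
theorem root_alternatingWord {i j : B} (hij : i ≠ j) (k : ℕ) :
    cs.root (cs.wordProd (alternatingWord i j k)) i =
      if Even k then
        dihedralCoeff (M i j) (k + 1) • Pi.single i 1 + dihedralCoeff (M i j) k • Pi.single j 1
      else
        dihedralCoeff (M i j) k • Pi.single i 1 +
          dihedralCoeff (M i j) (k + 1) • Pi.single j 1 := by
  have h1 := M.off_diagonal i j hij
  induction k with
  | zero => simp [alternatingWord, dihedralCoeff_one h1, dihedralCoeff_zero]
  | succ k ih =>
    have hc : (2 * Real.cos (Real.pi / M i j) : ℝ) = - M.cartan i j := by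
      rw [cartan]; ring
    rw [alternatingWord_succ', cs.wordProd_cons, root_mul, ih, geometricRep_simple]
    by_cases hk : Even k
    · simp only [hk, if_true, Nat.even_add_one, not_true, if_false, simpleReflection_apply, map_add,
        map_smul, coroot_single, cartan_self, dihedralCoeff_add_two, hc, M.cartan_symm j i]
      module
    · simp only [hk, if_true, Nat.even_add_one, not_false_eq_true, if_false,
        simpleReflection_apply, map_add, map_smul, coroot_single, cartan_self,
        dihedralCoeff_add_two, hc]
      module

theorem geometricRep_single_nonneg_combination {w : W} {i j : B} (hi : 0 ≤ cs.root w i)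
    (hj : 0 ≤ cs.root w j) {a b : ℝ} (ha : 0 ≤ a) (hb : 0 ≤ b) :
    0 ≤ cs.geometricRep w (a • Pi.single i 1 + b • Pi.single j 1) := by
  rw [map_add, map_smul, map_smul]
  exact add_nonneg (smul_nonneg ha hi) (smul_nonneg hb hj)

/-- Factor w = v·d with d dihedral: d α_i has nonnegative coefficients on α_i, α_j, and v, being
shorter, keeps both nonnegative by induction. -/
theorem root_nonneg_of_not_isRightDescent {w : W} {i : B} (hi : ¬cs.IsRightDescent w i) :
    0 ≤ cs.root w i := by
  induction h : cs.length w using Nat.strong_induction_on generalizing w i with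
  | _ n ih =>
    subst h
    by_cases hw : w = 1
    · simp [hw]
    obtain ⟨j, hj⟩ := cs.exists_rightDescent_of_ne_one hw
    have hij : i ≠ j := fun h => hi (h ▸ hj)
    have h1 := M.off_diagonal i j hij
    obtain ⟨v, k, hwv, hl, hlt, hvi, hvj⟩ := cs.exists_eq_mul_alternatingWord w i j hj hi
    have hpi := ih _ hlt hvi rfl
    have hpj := ih _ hlt hvj rfl
    -- Otherwise appending i gives an alternating word longer than `M i j`, so not reduced, although
    -- the length of w must increase.
    have hk : M i j ≠ 0 → k + 1 ≤ M i j := by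
      intro h0
      by_contra! hlt'
      rw [cs.not_isRightDescent_iff, hwv, mul_assoc, ← wordProd_concat, ← alternatingWord_succ,
        ← hwv] at hi
      rw [M.symmetric] at h0 hlt'
      refine cs.not_isReduced_alternatingWord j i h0 hlt' ?_
      have h2 := cs.length_mul_le v (cs.wordProd (alternatingWord j i (k + 1)))
      have h3 := cs.length_wordProd_le (alternatingWord j i (k + 1))
      rw [IsReduced]
      rw [length_alternatingWord] at h3 ⊢
      omega
    have hd := dihedralCoeff_nonneg h1 hk
    have hd' := dihedralCoeff_nonneg (k := k) h1 (fun h => by have := hk h; omega)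
    rw [hwv, root_mul, root_alternatingWord cs hij]
    split_ifs
    · exact cs.geometricRep_single_nonneg_combination hpi hpj hd hd'
    · exact cs.geometricRep_single_nonneg_combination hpi hpj hd' hd

theorem root_nonpos_of_isRightDescent {w : W} {i : B} (hi : cs.IsRightDescent w i) :
    cs.root w i ≤ 0 := by
  have h := cs.root_nonneg_of_not_isRightDescent (cs.isRightDescent_iff_not_isRightDescent_mul.1 hi)
  rw [root_mul_simple] at h
  exact neg_nonneg.1 h

theorem not_isRightDescent_of_root_nonneg {w : W} {i : B} (h : 0 ≤ cs.root w i) :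
    ¬cs.IsRightDescent w i := fun h' =>
  cs.root_ne_zero w i (le_antisymm (cs.root_nonpos_of_isRightDescent h') h)

theorem root_nonneg_of_pos_apply {w : W} {i t : B} (h : 0 < cs.root w i t) :
    0 ≤ cs.root w i := by
  by_contra h'
  have := cs.root_nonpos_of_isRightDescent
    (not_not.1 (mt cs.root_nonneg_of_not_isRightDescent h')) t
  exact this.not_gt h

theorem root_nonneg_or_nonpos (w : W) (i : B) : 0 ≤ cs.root w i ∨ cs.root w i ≤ 0 :=
  (em (cs.IsRightDescent w i)).symm.imp cs.root_nonneg_of_not_isRightDescent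
    cs.root_nonpos_of_isRightDescent

theorem eq_one_of_root_nonneg {w : W} (h : ∀ i, 0 ≤ cs.root w i) : w = 1 := by
  by_contra hw
  obtain ⟨i, hi⟩ := cs.exists_rightDescent_of_ne_one hw
  exact cs.not_isRightDescent_of_root_nonneg (h i) hi

end CoxeterSystem
-- The skew form and the symmetric form.
theorem List.sum_map_neg_real {α : Type*} (l : List α) (f : α → ℝ) :
    (l.map fun a => -f a).sum = -(l.map f).sum := by
  induction l with
  | nil => simp
  | cons a l ih => simp only [List.map_cons, List.sum_cons, ih]; ring

namespace CoxeterMatrix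

variable {B : Type*} (M : CoxeterMatrix B)

/-- The skew-symmetric form attached to a list of indices of simple reflections. If the list
enumerates the index set, this is the antisymmetrization of the Euler form of the corresponding
Coxeter element. -/
noncomputable def skewForm : List B → (B → ℝ) → (B → ℝ) → ℝ
  | [], _, _ => 0
  | i :: l, x, y =>
    (l.map fun j => M.cartan i j * x j).sum * y i - x i * (l.map fun j => M.cartan i j * y j).sum +
      skewForm l x y

theorem skewForm_congr {l : List B} {x x' y y' : B → ℝ} (hx : ∀ j ∈ l, x j = x' j)
    (hy : ∀ j ∈ l, y j = y' j) : M.skewForm l x y = M.skewForm l x' y' := by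
  induction l with
  | nil => rfl
  | cons i l ih =>
    simp only [List.mem_cons, forall_eq_or_imp] at hx hy
    rw [skewForm, skewForm, ih hx.2 hy.2, hx.1, hy.1,
      List.map_congr_left fun j hj => by rw [hx.2 j hj],
      List.map_congr_left (l := l) (f := fun j => M.cartan i j * y j)
        fun j hj => by rw [hy.2 j hj]]

theorem skewForm_zero_left (l : List B) (y : B → ℝ) : M.skewForm l 0 y = 0 := by
  induction l with
  | nil => rfl
  | cons i l ih => simp [skewForm, ih]

theorem skewForm_neg_left (l : List B) (x y : B → ℝ) :
    M.skewForm l (-x) y = -M.skewForm l x y := by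
  induction l with
  | nil => simp [skewForm]
  | cons i l ih =>
    have : (l.map fun j => M.cartan i j * (-x) j).sum =
        -(l.map fun j => M.cartan i j * x j).sum := by
      simp [List.sum_map_neg_real]
    rw [skewForm, skewForm, ih, this, Pi.neg_apply]
    ring

theorem skewForm_append_singleton (l : List B) (i : B) (x y : B → ℝ) :
    M.skewForm (l ++ [i]) x y = M.skewForm l x y +
      (x i * (l.map fun j => M.cartan i j * y j).sum -
        (l.map fun j => M.cartan i j * x j).sum * y i) := by
  induction l with
  | nil => simp [skewForm]
  | cons k l ih =>
    simp only [List.cons_append, skewForm, ih, List.map_append, List.sum_append, List.map_cons,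
      List.sum_cons, List.map_nil, List.sum_nil, M.cartan_symm k i]
    ring

section BilinearForm

variable [Fintype B]

/-- The canonical symmetric bilinear form of a Coxeter matrix. -/
noncomputable def bilinearForm (x y : B → ℝ) : ℝ := ∑ i, x i * M.coroot i y

theorem bilinearForm_comm (x y : B → ℝ) : M.bilinearForm x y = M.bilinearForm y x := by
  simp only [bilinearForm, coroot_apply, Finset.mul_sum]
  rw [Finset.sum_comm]
  refine Finset.sum_congr rfl fun i _ => Finset.sum_congr rfl fun j _ => ?_
  rw [M.cartan_symm j i]
  ring

theorem bilinearForm_sub_smul_right (x y z : B → ℝ) (c : ℝ) :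
    M.bilinearForm x (y - c • z) = M.bilinearForm x y - c * M.bilinearForm x z := by
  simp only [bilinearForm, map_sub, map_smul, smul_eq_mul, mul_sub, Finset.sum_sub_distrib,
    Finset.mul_sum]
  congr 1
  exact Finset.sum_congr rfl fun i _ => by ring

end BilinearForm

variable [DecidableEq B]

theorem skewForm_cons_single {i : B} {l : List B} (hi : i ∉ l) (y : B → ℝ) :
    M.skewForm (i :: l) (Pi.single i 1) y = (l.map fun j => -M.cartan i j * y j).sum := by
  have h : ∀ j ∈ l, (Pi.single i 1 : B → ℝ) j = (0 : B → ℝ) j := fun j hj => by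
    simp [ne_of_mem_of_not_mem hj hi]
  rw [skewForm, M.skewForm_congr h (fun _ _ => rfl), skewForm_zero_left,
    List.map_congr_left fun j hj => by rw [h j hj]]
  simp [List.sum_map_neg_real]

theorem skewForm_cons_single_nonneg {i : B} {l : List B} (hi : i ∉ l) {y : B → ℝ} (hy : 0 ≤ y) :
    0 ≤ M.skewForm (i :: l) (Pi.single i 1) y := by
  rw [skewForm_cons_single M hi]
  refine List.sum_nonneg ?_
  simp only [List.mem_map, forall_exists_index, and_imp, forall_apply_eq_imp_iff₂]
  intro j hj
  exact mul_nonneg (neg_nonneg.2 (M.cartan_nonpos (ne_of_mem_of_not_mem hj hi).symm)) (hy j)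

theorem apply_eq_zero_of_skewForm_cons_single_nonpos {i : B} {l : List B} (hi : i ∉ l)
    {y : B → ℝ} (hy : 0 ≤ y) (h : M.skewForm (i :: l) (Pi.single i 1) y ≤ 0) {r : B} (hr : r ∈ l)
    (hir : M.diagramGraph.Adj i r) : y r = 0 := by
  rw [skewForm_cons_single M hi] at h
  have hle : -M.cartan i r * y r ≤ (l.map fun j => -M.cartan i j * y j).sum := by
    refine List.single_le_sum ?_ _ (List.mem_map.2 ⟨r, hr, rfl⟩)
    simp only [List.mem_map, forall_exists_index, and_imp, forall_apply_eq_imp_iff₂]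
    intro j hj
    exact mul_nonneg (neg_nonneg.2 (M.cartan_nonpos (ne_of_mem_of_not_mem hj hi).symm)) (hy j)
  have := M.cartan_neg_of_adj hir
  have hyr : 0 ≤ y r := hy r
  nlinarith

variable [Fintype B]

theorem coroot_apply_eq_sum {i : B} {l : List B} (hl : (i :: l).Nodup) (hmem : ∀ j, j ∈ i :: l)
    (x : B → ℝ) : M.coroot i x = 2 * x i + (l.map fun j => M.cartan i j * x j).sum := by
  have : (Finset.univ : Finset B) = (i :: l).toFinset := by ext; simpa using hmem _
  rw [coroot_apply, this, List.sum_toFinset _ hl]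
  simp

/-- The reflection changes only coordinate i, and the products of the two sums over l cancel by
skewness. -/
theorem skewForm_rotate {i : B} {l : List B} (hl : (i :: l).Nodup) (hmem : ∀ j, j ∈ i :: l)
    (x y : B → ℝ) :
    M.skewForm (l ++ [i]) (M.simpleReflection i x) (M.simpleReflection i y) =
      M.skewForm (i :: l) x y := by
  have h (x : B → ℝ) : ∀ j ∈ l, M.simpleReflection i x j = x j := fun j hj =>
    M.simpleReflection_apply_of_ne (ne_of_mem_of_not_mem hj (List.nodup_cons.1 hl).1) x
  have hs (x : B → ℝ) : (l.map fun j => M.cartan i j * M.simpleReflection i x j) =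
      l.map fun j => M.cartan i j * x j := List.map_congr_left fun j hj => by rw [h x j hj]
  rw [skewForm_append_singleton, hs, hs, M.skewForm_congr (h x) (h y), simpleReflection_apply_self,
    simpleReflection_apply_self, M.coroot_apply_eq_sum hl hmem, M.coroot_apply_eq_sum hl hmem,
    skewForm]
  ring

theorem bilinearForm_single_left (i : B) (y : B → ℝ) :
    M.bilinearForm (Pi.single i 1) y = M.coroot i y := by
  simp [bilinearForm, Pi.single_apply]

theorem bilinearForm_simpleReflection (i : B) (x : B → ℝ) :
    M.bilinearForm (M.simpleReflection i x) (M.simpleReflection i x) = M.bilinearForm x x := by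
  rw [simpleReflection_apply, bilinearForm_sub_smul_right, bilinearForm_comm _ _ x,
    bilinearForm_comm _ _ (Pi.single i 1), bilinearForm_sub_smul_right, bilinearForm_sub_smul_right,
    bilinearForm_comm _ x (Pi.single i 1), bilinearForm_single_left, bilinearForm_single_left,
    coroot_single_self]
  ring

end CoxeterMatrix

/-! ### Roots. -/

namespace CoxeterSystem

open CoxeterMatrix

variable {B W : Type*} [Group W] {M : CoxeterMatrix B} (cs : CoxeterSystem M W)
  [Fintype B] [DecidableEq B]

/-- A root is an image of a simple root under an element of the Coxeter group. -/
def IsRoot (γ : B → ℝ) : Prop := ∃ w i, cs.root w i = γ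

variable {cs}

theorem IsRoot.geometricRep {γ : B → ℝ} (h : cs.IsRoot γ) (w : W) :
    cs.IsRoot (cs.geometricRep w γ) := by
  obtain ⟨v, i, rfl⟩ := h
  exact ⟨w * v, i, cs.root_mul w v i⟩

theorem IsRoot.neg {γ : B → ℝ} (h : cs.IsRoot γ) : cs.IsRoot (-γ) := by
  obtain ⟨v, i, rfl⟩ := h
  exact ⟨v * cs.simple i, i, cs.root_mul_simple v i⟩

theorem IsRoot.nonneg_or_nonpos {γ : B → ℝ} (h : cs.IsRoot γ) : 0 ≤ γ ∨ γ ≤ 0 := by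
  obtain ⟨v, i, rfl⟩ := h
  exact cs.root_nonneg_or_nonpos v i

theorem IsRoot.bilinearForm_self {γ : B → ℝ} (h : cs.IsRoot γ) : M.bilinearForm γ γ = 2 := by
  obtain ⟨v, i, rfl⟩ := h
  induction v using cs.simple_induction_left with
  | one => rw [root_one, bilinearForm_single_left, coroot_single_self]
  | mul_simple_left w j ih =>
    rw [root_mul, geometricRep_simple, bilinearForm_simpleReflection, ih]

/-- Coordinates other than i are unchanged, so a sign change forces them to vanish; the invariant
norm 2 then fixes the multiple of α_i. -/
theorem IsRoot.eq_single {γ : B → ℝ} (h : cs.IsRoot γ) {i : B} (h0 : 0 ≤ γ)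
    (hs : ¬0 ≤ M.simpleReflection i γ) : γ = Pi.single i 1 := by
  have hs' : M.simpleReflection i γ ≤ 0 := by
    rw [← cs.geometricRep_simple] at hs ⊢
    exact (h.geometricRep _).nonneg_or_nonpos.resolve_left hs
  have hγ : γ = γ i • Pi.single i 1 := by
    ext t
    by_cases ht : t = i
    · simp [ht]
    · have := hs' t
      rw [M.simpleReflection_apply_of_ne ht] at this
      simpa [ht] using le_antisymm this (h0 t)
  have hq := h.bilinearForm_self
  have hi : 0 ≤ γ i := h0 i
  generalize γ i = c at hγ hi
  subst hγ
  have hc : c * (c * 2) = 2 := by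
    simpa [bilinearForm, Pi.single_apply, coroot_single_self] using hq
  rw [show c = 1 by nlinarith, one_smul]

end CoxeterSystem
-- Finitely many roots imply a finite component.
namespace CoxeterSystem

open CoxeterMatrix

variable {B W : Type*} [Group W] {M : CoxeterMatrix B} (cs : CoxeterSystem M W)

theorem finite_standardParabolic_of_forall_not_adj (i : B) (h : ∀ r, ¬M.diagramGraph.Adj i r) :
    Finite (cs.standardParabolic (M.diagramGraph.connectedComponentMk i).supp) := by
  have hsupp : (M.diagramGraph.connectedComponentMk i).supp = {i} := by
    ext t
    simp only [SimpleGraph.ConnectedComponent.mem_supp_iff, SimpleGraph.ConnectedComponent.eq,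
      Set.mem_singleton_iff]
    constructor
    · rintro hti
      obtain ⟨p⟩ := hti.symm
      cases p with
      | nil => rfl
      | cons hadj _ => exact absurd hadj (h _)
    · rintro rfl
      rfl
  rw [hsupp, standardParabolic, Set.image_singleton, ← Subgroup.zpowers_eq_closure]
  have : IsOfFinOrder (cs.simple i) :=
    isOfFinOrder_iff_pow_eq_one.2 ⟨2, by norm_num, cs.simple_sq i⟩
  exact this.finite_zpowers

variable [Fintype B] [DecidableEq B]

/-- The positive roots made negative by `w`. -/
def rootInversions (w : W) : Set (B → ℝ) :=
  {γ | cs.IsRoot γ ∧ 0 ≤ γ ∧ ¬0 ≤ cs.geometricRep w γ}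

theorem finite_rootInversions (w : W) : (cs.rootInversions w).Finite := by
  induction w using cs.simple_induction_right with
  | one =>
    convert Set.finite_empty
    ext γ
    simp only [rootInversions, map_one, Set.mem_ofPred_eq, LinearEquiv.coe_one, id_eq]
    tauto
  | mul_simple_right w i ih =>
    have hinj := (M.simpleReflection i).injective
    refine ((Set.finite_singleton (Pi.single i 1)).union
      (ih.preimage hinj.injOn)).subset fun γ ⟨hr, h0, hw⟩ => ?_
    by_cases hs : 0 ≤ M.simpleReflection i γ
    · refine Or.inr ⟨?_, hs, ?_⟩
      · rw [← cs.geometricRep_simple]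
        exact hr.geometricRep _
      · rwa [map_mul, LinearEquiv.mul_apply, geometricRep_simple] at hw
    · exact Or.inl (hr.eq_single h0 hs)

/-- The roots having the simple root of index `r` in their support. -/
def rootsThrough (r : B) : Set (B → ℝ) := {γ | cs.IsRoot γ ∧ γ r ≠ 0}

variable {cs}

theorem coroot_ne_zero_of_adj {γ : B → ℝ} {r t : B} (h0 : 0 ≤ γ) (hr : γ r = 0) (ht : γ t ≠ 0)
    (hrt : M.diagramGraph.Adj r t) : M.coroot r γ ≠ 0 := by
  rw [coroot_apply]
  refine ne_of_lt (Finset.sum_neg' (fun j _ => ?_) ⟨t, Finset.mem_univ t, ?_⟩)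
  · by_cases hj : r = j
    · simp [← hj, hr]
    · exact mul_nonpos_of_nonpos_of_nonneg (M.cartan_nonpos hj) (h0 j)
  · exact mul_neg_of_neg_of_pos (M.cartan_neg_of_adj hrt) (lt_of_le_of_ne (h0 t) ht.symm)

/-- A root through t passes through r, or its image under the reflection r does. -/
theorem finite_rootsThrough_of_adj {r t : B} (hrt : M.diagramGraph.Adj r t)
    (h : (cs.rootsThrough r).Finite) : (cs.rootsThrough t).Finite := by
  have hinj := (M.simpleReflection r).injective
  refine (h.union (h.preimage hinj.injOn)).subset fun γ ⟨hγ, ht⟩ => ?_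
  by_cases hr : γ r = 0
  · refine Or.inr ⟨?_, ?_⟩
    · rw [← cs.geometricRep_simple]
      exact hγ.geometricRep _
    · rw [simpleReflection_apply_self, hr, zero_sub, neg_ne_zero]
      rcases hγ.nonneg_or_nonpos with h0 | h0
      · exact coroot_ne_zero_of_adj h0 hr ht hrt
      · rw [← neg_ne_zero, ← map_neg]
        exact coroot_ne_zero_of_adj (neg_nonneg.2 h0) (by simp [hr]) (by simpa using ht) hrt
  · exact Or.inl ⟨hγ, hr⟩

theorem finite_rootsThrough_of_reachable {r t : B} (hrt : M.diagramGraph.Reachable r t)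
    (h : (cs.rootsThrough r).Finite) : (cs.rootsThrough t).Finite := by
  obtain ⟨p⟩ := hrt
  induction p with
  | nil => exact h
  | cons hadj _ ih => exact ih (finite_rootsThrough_of_adj hadj h)

theorem finite_rootsThrough_of_forall_mem {r : B} {w : W}
    (h : ∀ γ, cs.IsRoot γ → 0 ≤ γ → 0 ≤ cs.geometricRep w γ → γ r = 0) :
    (cs.rootsThrough r).Finite := by
  have hfin := cs.finite_rootInversions w
  refine (hfin.union (hfin.preimage neg_injective.injOn)).subset fun γ ⟨hγ, hr⟩ => ?_
  rcases hγ.nonneg_or_nonpos with h0 | h0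
  · exact Or.inl ⟨hγ, h0, fun hw => hr (h γ hγ h0 hw)⟩
  · refine Or.inr ⟨hγ.neg, neg_nonneg.2 h0, fun hw => hr ?_⟩
    simpa using h (-γ) hγ.neg (neg_nonneg.2 h0) hw

variable (cs)

theorem geometricRep_apply_of_mem_standardParabolic {I : Set B} {w : W}
    (hw : w ∈ cs.standardParabolic I) {t : B} (ht : t ∉ I) (x : B → ℝ) :
    cs.geometricRep w x t = x t := by
  induction hw using Subgroup.closure_induction generalizing x with
  | mem v hv =>
    obtain ⟨i, hi, rfl⟩ := hv
    rw [geometricRep_simple, simpleReflection_apply_of_ne _ (ne_of_mem_of_not_mem hi ht).symm]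
  | one => simp
  | mul v v' _ _ h h' => rw [map_mul, LinearEquiv.mul_apply, h, h']
  | inv v _ h =>
    rw [← h (cs.geometricRep v⁻¹ x), ← LinearEquiv.mul_apply, ← map_mul, mul_inv_cancel, map_one,
      LinearEquiv.coe_one, id]

theorem root_of_mem_standardParabolic_of_not_mem {C : M.diagramGraph.ConnectedComponent} {w : W}
    (hw : w ∈ cs.standardParabolic C.supp) {i : B} (hi : i ∉ C.supp) :
    cs.root w i = Pi.single i 1 := by
  rw [root]
  induction hw using Subgroup.closure_induction with
  | mem v hv =>
    obtain ⟨j, hj, rfl⟩ := hv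
    have hM : M j i = 2 := by
      by_contra hM
      exact hi (C.mem_supp_of_adj_mem_supp hj ⟨ne_of_mem_of_not_mem hj hi, hM⟩)
    simp [simpleReflection_apply, coroot_single, M.cartan_eq_zero_of_eq_two hM]
  | one => simp
  | mul v v' _ _ h h' => rw [map_mul, LinearEquiv.mul_apply, h', h]
  | inv v _ h =>
    conv_lhs => rw [← h]
    rw [← LinearEquiv.mul_apply, ← map_mul, inv_mul_cancel, map_one, LinearEquiv.coe_one, id]

/-- An element of the parabolic fixes the simple roots outside C, so it is determined by its values
on those in C, which lie in a finite set. -/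
theorem finite_standardParabolic_of_finite_rootsThrough (C : M.diagramGraph.ConnectedComponent)
    (h : ∀ r ∈ C.supp, (cs.rootsThrough r).Finite) : Finite (cs.standardParabolic C.supp) := by
  set T : Set (B → ℝ) := ⋃ r ∈ C.supp, cs.rootsThrough r
  have hT : T.Finite := (Set.toFinite C.supp).biUnion h
  have := hT.to_subtype
  have hmem (w : cs.standardParabolic C.supp) (i : C.supp) : cs.root w i ∈ T := by
    by_contra hn
    simp only [T, Set.mem_iUnion, not_exists] at hn
    refine cs.root_ne_zero w i (funext fun t => ?_)
    by_cases ht : t ∈ C.supp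
    · by_contra h0
      exact hn t ht ⟨⟨w, i, rfl⟩, h0⟩
    · rw [root, cs.geometricRep_apply_of_mem_standardParabolic w.2 ht]
      simp [ne_of_mem_of_not_mem i.2 ht |>.symm]
  let f : cs.standardParabolic C.supp → (C.supp → T) := fun w i => ⟨cs.root w i, hmem w i⟩
  refine Finite.of_injective f fun v w hvw => ?_
  suffices ((w : W)⁻¹ * v) = 1 from Subtype.ext (inv_mul_eq_one.1 this).symm
  refine cs.eq_one_of_root_nonneg fun i => ?_
  have : cs.root ((w : W)⁻¹ * v) i = Pi.single i 1 := by
    by_cases hi : i ∈ C.supp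
    · have : cs.root v i = cs.root w i := congrArg Subtype.val (congrFun hvw ⟨i, hi⟩)
      rw [root_mul, this, ← root_mul, inv_mul_cancel, root_one]
    · exact cs.root_of_mem_standardParabolic_of_not_mem (mul_mem (inv_mem w.2) v.2) hi
  rw [this]
  simp

theorem finite_standardParabolic_of_forall_adj_apply_eq_zero {i : B} {w : W}
    (h : ∀ γ, cs.IsRoot γ → 0 ≤ γ → 0 ≤ cs.geometricRep w γ →
      ∀ r, M.diagramGraph.Adj i r → γ r = 0) :
    Finite (cs.standardParabolic (M.diagramGraph.connectedComponentMk i).supp) := by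
  by_cases hi : ∃ r, M.diagramGraph.Adj i r
  · obtain ⟨r, hr⟩ := hi
    refine cs.finite_standardParabolic_of_finite_rootsThrough _ fun t ht => ?_
    have hti : M.diagramGraph.Reachable t i := SimpleGraph.ConnectedComponent.exact ht
    exact finite_rootsThrough_of_reachable (hr.reachable.symm.trans hti.symm)
      (finite_rootsThrough_of_forall_mem fun γ h1 h2 h3 => h γ h1 h2 h3 r hr)
  · exact cs.finite_standardParabolic_of_forall_not_adj i (not_exists.1 hi)

end CoxeterSystem

/-! ### Periodic words and their reducedness. -/

/-- The prefix of length `k` of the infinite periodic word with period `l`. -/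
def List.cyclicWord {α : Type*} : List α → ℕ → List α
  | _, 0 => []
  | [], _ => []
  | i :: l, k + 1 => i :: cyclicWord (l ++ [i]) k

namespace List

variable {α : Type*}

@[simp] theorem cyclicWord_zero (l : List α) : l.cyclicWord 0 = [] := by
  cases l <;> rfl

theorem cyclicWord_append_add (l₁ l₂ : List α) (k : ℕ) :
    (l₁ ++ l₂).cyclicWord (l₁.length + k) = l₁ ++ (l₂ ++ l₁).cyclicWord k := by
  induction l₁ generalizing l₂ with
  | nil => simp
  | cons i l ih =>
    rw [cons_append, length_cons, Nat.add_right_comm, cyclicWord, append_assoc, ih]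
    simp

theorem cyclicWord_mul_length (l : List α) (m : ℕ) :
    l.cyclicWord (m * l.length) = (replicate m l).flatten := by
  induction m with
  | zero => simp
  | succ m ih =>
    have := cyclicWord_append_add l [] (m * l.length)
    rw [append_nil, nil_append, ih] at this
    rw [Nat.succ_mul, Nat.add_comm, this, replicate_succ, flatten_cons]

end List

namespace CoxeterSystem

open CoxeterMatrix

variable {B W : Type*} [Group W] {M : CoxeterMatrix B} (cs : CoxeterSystem M W)

/-- Iterated rotation: j heads the word rotated k times. -/
theorem exists_cyclicWord_succ [Fintype B] [DecidableEq B] {l : List B} (hl : l.Nodup)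
    (hmem : ∀ i, i ∈ l) (hne : l ≠ []) (k : ℕ) :
    ∃ j l', (j :: l').Nodup ∧ (∀ i, i ∈ j :: l') ∧
      l.cyclicWord (k + 1) = l.cyclicWord k ++ [j] ∧
      ∀ x y, M.skewForm l (cs.geometricRep (cs.wordProd (l.cyclicWord k)) x)
        (cs.geometricRep (cs.wordProd (l.cyclicWord k)) y) = M.skewForm (j :: l') x y := by
  induction k generalizing l with
  | zero =>
    cases l with
    | nil => exact absurd rfl hne
    | cons i l => exact ⟨i, l, hl, hmem, by simp [List.cyclicWord], by simp⟩
  | succ k ih =>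
    cases l with
    | nil => exact absurd rfl hne
    | cons i l =>
      have hperm : (l ++ [i]).Perm (i :: l) := List.perm_append_singleton i l
      obtain ⟨j, l', h1, h2, h3, h4⟩ := ih (hperm.nodup_iff.2 hl)
        (fun t => hperm.mem_iff.2 (hmem t)) (by simp)
      refine ⟨j, l', h1, h2, ?_, fun x y => ?_⟩
      · rw [List.cyclicWord, h3, List.cyclicWord, List.cons_append]
      · rw [List.cyclicWord, wordProd_cons, map_mul, LinearEquiv.mul_apply, LinearEquiv.mul_apply,
          geometricRep_simple, ← h4, ← M.skewForm_rotate hl hmem]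
        simp only [← LinearEquiv.mul_apply, ← mul_assoc, simpleReflection_mul_self, one_mul]

theorem isReduced_concat_iff {ω : List B} (h : cs.IsReduced ω) (i : B) :
    cs.IsReduced (ω ++ [i]) ↔ ¬cs.IsRightDescent (cs.wordProd ω) i := by
  rw [IsReduced, not_isRightDescent_iff, wordProd_append, wordProd_singleton, h.eq]
  simp

theorem isReduced_cyclicWord [Fintype B] [DecidableEq B] (h : cs.HasOnlyInfiniteComponents)
    {l : List B} (hl : l.Nodup) (hmem : ∀ i, i ∈ l) (k : ℕ) : cs.IsReduced (l.cyclicWord k) := by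
  induction k generalizing l with
  | zero => simp [IsReduced]
  | succ k ih =>
    cases l with
    | nil => simp [IsReduced, List.cyclicWord]
    | cons i l =>
      obtain ⟨j, l', hl', hmem', hj, hω⟩ := cs.exists_cyclicWord_succ hl hmem (by simp) k
      have hpre := ih hl hmem
      rw [hj, cs.isReduced_concat_iff hpre]
      intro hdes
      cases k with
      | zero => exact cs.not_isRightDescent_one j (by simpa using hdes)
      | succ k =>
        have hperm : (l ++ [i]).Perm (i :: l) := List.perm_append_singleton i l
        -- Induction over all enumerations covers the rotated word, so dropping the first letter
        -- leaves a reduced word ending in j.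
        have htail := ih (hperm.nodup_iff.2 hl) (fun t => hperm.mem_iff.2 (hmem t))
        rw [List.cyclicWord, List.cyclicWord, List.cons_append] at hj
        rw [(List.cons.inj hj).2] at htail
        rw [List.cyclicWord] at hdes hω
        set v := cs.wordProd ((l ++ [i]).cyclicWord k)
        set w := cs.wordProd (i :: (l ++ [i]).cyclicWord k)
        have hwv : w = cs.simple i * v := cs.wordProd_cons _ _
        have hvred : cs.IsReduced ((l ++ [i]).cyclicWord k) := by
          simpa using htail.take ((l ++ [i]).cyclicWord k).length
        have hvj : ¬cs.IsRightDescent v j := (cs.isReduced_concat_iff hvred j).1 htail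
        have hneg := cs.root_nonpos_of_isRightDescent hdes
        have hvi : cs.root v j = Pi.single i 1 := by
          refine IsRoot.eq_single ⟨v, j, rfl⟩ (cs.root_nonneg_of_not_isRightDescent hvj) fun h0 => ?_
          rw [← cs.geometricRep_simple, ← root_mul, ← hwv] at h0
          exact cs.not_isRightDescent_of_root_nonneg h0 hdes
        have hwi : cs.root w j = -Pi.single i 1 := by
          rw [hwv, root_mul, hvi, geometricRep_simple, simpleReflection_apply, coroot_single_self]
          module
        refine not_finite_iff_infinite.2 (h (M.diagramGraph.connectedComponentMk i)) ?_
        refine cs.finite_standardParabolic_of_forall_adj_apply_eq_zero (w := w⁻¹)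
          fun γ _ h0 hγ r hr => ?_
        have hil : i ∉ l := (List.nodup_cons.1 hl).1
        refine M.apply_eq_zero_of_skewForm_cons_single_nonpos hil h0 ?_
          ((List.mem_cons.1 (hmem r)).resolve_left hr.ne') hr
        -- Transported by w, this reads ω(-α_i, γ) ≥ 0, the opposite sign.
        have hpos := M.skewForm_cons_single_nonneg (List.nodup_cons.1 hl').1 hγ
        rw [← hω, ← root, hwi, ← LinearEquiv.mul_apply, ← map_mul, mul_inv_cancel, map_one,
          LinearEquiv.coe_one, id, skewForm_neg_left] at hpos
        linarith

/-- Letters other than i leave coordinate i of α_i equal to 1, so a new letter i is never a descent.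
-/
theorem isReduced_of_nodup [Fintype B] [DecidableEq B] {l : List B} (hl : l.Nodup) :
    cs.IsReduced l := by
  induction l using List.reverseRecOn with
  | nil => simp [IsReduced]
  | append_singleton l i ih =>
    have hil : i ∉ l := fun h => List.disjoint_of_nodup_append hl h (by simp)
    rw [cs.isReduced_concat_iff (ih hl.of_append_left)]
    refine cs.not_isRightDescent_of_root_nonneg (cs.root_nonneg_of_pos_apply (t := i) ?_)
    have : cs.wordProd l ∈ cs.standardParabolic {j | j ∈ l} := by
      rw [wordProd]
      refine Subgroup.list_prod_mem _ fun x hx => ?_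
      obtain ⟨j, hj, rfl⟩ := List.mem_map.1 hx
      exact Subgroup.subset_closure ⟨j, hj, rfl⟩
    rw [root, cs.geometricRep_apply_of_mem_standardParabolic this hil]
    simp

/-! ### Splitting off a component. -/

theorem simple_commute_of_eq_two {i j : B} (h : M i j = 2) :
    Commute (cs.simple i) (cs.simple j) := by
  have h1 := cs.simple_mul_simple_pow i j
  rw [h, pow_two, mul_eq_one_iff_eq_inv, mul_inv_rev, inv_simple, inv_simple] at h1
  exact h1

theorem commute_of_mem_standardParabolic {I : Set B} {i : B} (h : ∀ j ∈ I, M i j = 2) {w : W}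
    (hw : w ∈ cs.standardParabolic I) : Commute (cs.simple i) w := by
  suffices cs.standardParabolic I ≤ Subgroup.centralizer {cs.simple i} from
    (Subgroup.mem_centralizer_singleton_iff.1 (this hw)).symm
  rw [standardParabolic, Subgroup.closure_le]
  rintro _ ⟨j, hj, rfl⟩
  exact Subgroup.mem_centralizer_singleton_iff.2 (cs.simple_commute_of_eq_two (h j hj)).symm

open Classical in
theorem exists_wordProd_eq_mul_of_connectedComponent (C : M.diagramGraph.ConnectedComponent)
    (l : List B) : ∃ v ∈ cs.standardParabolic C.supp,
      Commute v (cs.wordProd (l.filter (· ∉ C.supp))) ∧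
      cs.wordProd l = v * cs.wordProd (l.filter (· ∉ C.supp)) := by
  induction l with
  | nil => exact ⟨1, one_mem _, by simp, by simp⟩
  | cons i l ih =>
    obtain ⟨v, hv, hcomm, hl⟩ := ih
    have hM {i j : B} (hi : i ∉ C.supp) (hj : j ∈ C.supp) : M i j = 2 := by
      by_contra hM
      exact hi (C.mem_supp_of_adj_mem_supp hj
        ⟨ne_of_mem_of_not_mem hj hi, by rwa [M.symmetric]⟩)
    by_cases hi : i ∈ C.supp
    · have hic : Commute (cs.simple i) (cs.wordProd (l.filter (· ∉ C.supp))) := by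
        rw [wordProd]
        refine Commute.list_prod_right _ _ fun x hx => ?_
        obtain ⟨j, hj, rfl⟩ := List.mem_map.1 hx
        have hj' : j ∉ C.supp := by simpa using (List.mem_filter.1 hj).2
        exact (cs.simple_commute_of_eq_two (hM hj' hi)).symm
      refine ⟨cs.simple i * v, mul_mem (Subgroup.subset_closure ⟨i, hi, rfl⟩) hv, ?_, ?_⟩
      · rw [List.filter_cons_of_neg (by simpa using hi)]
        exact hic.mul_left hcomm
      · rw [List.filter_cons_of_neg (by simpa using hi), wordProd_cons, hl, mul_assoc]
    · have hiv := cs.commute_of_mem_standardParabolic (fun j hj => hM hi hj) hv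
      refine ⟨v, hv, ?_, ?_⟩
      · rw [List.filter_cons_of_pos (by simpa using hi), wordProd_cons]
        exact hiv.symm.mul_right hcomm
      · rw [List.filter_cons_of_pos (by simpa using hi), wordProd_cons, wordProd_cons, hl,
          ← mul_assoc, hiv.eq, mul_assoc]

theorem wordProd_flatten_replicate (l : List B) (m : ℕ) :
    cs.wordProd (List.replicate m l).flatten = cs.wordProd l ^ m := by
  induction m with
  | zero => simp
  | succ m ih => rw [List.replicate_succ, List.flatten_cons, wordProd_append, ih, pow_succ']

end CoxeterSystem

theorem mainTheorem6 {B W : Type*} [Group W] {M : CoxeterMatrix B} (cs : CoxeterSystem M W)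
    (u : W) (hu : cs.IsCoxeterElement u) :
    cs.IsStraight u ↔ cs.HasOnlyInfiniteComponents := by
  classical
  obtain ⟨l, hl, hmem, rfl⟩ := hu
  let _ : Fintype B := ⟨l.toFinset, fun i => List.mem_toFinset.2 (hmem i)⟩
  have hlen : cs.length (cs.wordProd l) = l.length := cs.isReduced_of_nodup hl
  constructor
  · intro h C
    by_contra hfin
    rw [not_infinite_iff_finite] at hfin
    obtain ⟨v, hv, hcomm, hlv⟩ := cs.exists_wordProd_eq_mul_of_connectedComponent C l
    generalize hl' : List.filter _ l = l' at hcomm hlv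
    -- The m-th power kills v, leaving m copies of the strictly shorter word l'.
    set m := Nat.card (cs.standardParabolic C.supp)
    have hm0 : 0 < m := Nat.card_pos
    have hvm : v ^ m = 1 := by
      have := pow_card_eq_one' (x := (⟨v, hv⟩ : cs.standardParabolic C.supp))
      exact congrArg Subtype.val this
    have hlt : l'.length < l.length := by
      obtain ⟨i, hi⟩ := C.nonempty_supp
      rw [← hl']
      exact List.length_filter_lt_length_iff_exists.2 ⟨i, hmem i, by simpa using hi⟩
    have hpow := h m
    rw [hlen, hlv, hcomm.mul_pow, hvm, one_mul, ← cs.wordProd_flatten_replicate] at hpow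
    have hle := cs.length_wordProd_le (List.replicate m l').flatten
    rw [hpow, List.length_flatten, List.map_replicate, List.sum_replicate, smul_eq_mul] at hle
    exact absurd (Nat.le_of_mul_le_mul_left hle hm0) (not_le.2 hlt)
  · intro h m
    have hred := cs.isReduced_cyclicWord h hl hmem (m * l.length)
    rw [List.cyclicWord_mul_length, CoxeterSystem.IsReduced,
      cs.wordProd_flatten_replicate] at hred
    rw [hred, hlen]
    simp
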